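/- For a monoid $M$, let $\mathbf{Sets}_M$ denote the topos of sets with a left $M$-action and $M$-equivariant maps. A geometric morphism $f:\mathcal E\to\mathcal F$ of toposes is an adjunction $f^*\dashv f_*$ with $f_*:\mathcal E\to\mathcal F$ and with $f^*:\mathcal F\to\mathcal E$ preserving finite limits; two geometric morphisms are isomorphic if their inverse image functors $f^*$ are naturally isomorphic. It is called hyperconnected if $f^*$ is full and faithful and its essential image is closed under subobjects and quotients. A point of a topos $\mathcal E$ is a geometric morphism $\mathbf{Sets}\to\mathcal E$. Let $M_1$ be the free monoid on the set $\mathbb R$ (finite sequences of real numbers under concatenation), let $M_2$ be the free commutative monoid on the set $\mathbb R$ (finitely supported functions $\mathbb R\to\mathbb N$ under addition), and let $\psi:M_1\to M_2$ be the abelianization map, which sends a finite sequence $s$ to the function $f_s$ with $f_s(x)$ the number of times that $x$ occurs in $s$. Let $\Psi:\mathbf{Sets}_{M_1}\to\mathbf{Sets}_{M_2}$ be the geometric morphism induced by $\psi$: its inverse image functor $\Psi^*$ is restriction of the action along $\psi$, and its direct image functor is $X\mapsto\mathrm{Hom}_{M_1}(M_2,X)$. Then: 1. $\Psi$ is hyperconnected;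 2. the set of isomorphism classes of points of $\mathbf{Sets}_{M_1}$ has the cardinality of the continuum; 3. the set of isomorphism classes of points of $\mathbf{Sets}_{M_2}$ has cardinality $2^{|\mathbb R|}$; 4. the map $[p]\mapsto[\Psi\circ p]$, from isomorphism classes of points of $\mathbf{Sets}_{M_1}$ to isomorphism classes of points of $\mathbf{Sets}_{M_2}$, is not surjective. -/

import Mathlib

open CategoryTheory CategoryTheory.Limits

universe u v₁ v₂ v₃ u₁ u₂ u₃

/-- A geometric morphism `f : E ⟶ F` between toposes: a direct image functor `f_* : E ⥤ F`, an
inverse image functor `f^* : F ⥤ E`, and an adjunction `f^* ⊣ f_*`, where `f^*` preserves finite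
limits. -/
structure GeomMorphism (E : Type u₁) [Category.{v₁} E] (F : Type u₂) [Category.{v₂} F] where
  /-- The direct image functor `f_*`. -/
  direct : E ⥤ F
  /-- The inverse image functor `f^*`. -/
  inverse : F ⥤ E
  /-- The adjunction `f^* ⊣ f_*`. -/
  adj : inverse ⊣ direct
  /-- The inverse image functor is left exact. -/
  preservesFiniteLimits : PreservesFiniteLimits inverse

namespace GeomMorphism

variable {E : Type u₁} [Category.{v₁} E] {F : Type u₂} [Category.{v₂} F]
  {K : Type u₃} [Category.{v₃} K]

/-- The composite `E ⟶ F ⟶ K` of two geometric morphisms. -/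
def comp (f : GeomMorphism E F) (g : GeomMorphism F K) : GeomMorphism E K where
  direct := f.direct ⋙ g.direct
  inverse := g.inverse ⋙ f.inverse
  adj := g.adj.comp f.adj
  preservesFiniteLimits :=
    haveI := f.preservesFiniteLimits
    haveI := g.preservesFiniteLimits
    comp_preservesFiniteLimits g.inverse f.inverse

/-- Two geometric morphisms are isomorphic if their inverse image functors are naturally
isomorphic (a geometric transformation `f ⟶ g` is a natural transformation `f^* ⟶ g^*`). -/
instance isoSetoid (E : Type u₁) [Category.{v₁} E] (F : Type u₂) [Category.{v₂} F] :
    Setoid (GeomMorphism E F) where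
  r f g := Nonempty (f.inverse ≅ g.inverse)
  iseqv :=
    { refl := fun _ => ⟨Iso.refl _⟩
      symm := fun ⟨a⟩ => ⟨a.symm⟩
      trans := fun ⟨a⟩ ⟨b⟩ => ⟨a ≪≫ b⟩ }

/-- A geometric morphism is hyperconnected if its inverse image functor is full and faithful and
the essential image of the inverse image functor is closed under subobjects and quotients. -/
structure IsHyperconnected (f : GeomMorphism E F) : Prop where
  full : f.inverse.Full
  faithful : f.inverse.Faithful
  closedUnderSubobjects : f.inverse.essImage.IsClosedUnderSubobjects
  closedUnderQuotients : f.inverse.essImage.IsClosedUnderQuotients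

end GeomMorphism

/-- The points of a topos `E`: geometric morphisms from the topos of sets to `E`. -/
abbrev ToposPoint (E : Type u₁) [Category.{v₁} E] := GeomMorphism (Type u) E

/-- The isomorphism classes of points of a topos. -/
abbrev PointClasses (E : Type u₁) [Category.{v₁} E] :=
  Quotient (GeomMorphism.isoSetoid (Type u) E)

/-- The map on isomorphism classes of points, `[p] ↦ [f ∘ p]`, induced by a geometric morphism. -/
def GeomMorphism.mapPoints {E : Type u₁} [Category.{v₁} E] {F : Type u₂} [Category.{v₂} F]
    (f : GeomMorphism E F) : PointClasses.{u} E → PointClasses.{u} F :=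
  Quotient.map (fun p : ToposPoint.{u} E => p.comp f)
    (fun _ _ ⟨a⟩ => ⟨Functor.isoWhiskerLeft f.inverse a⟩)

/-- The topos of sets with a left action of the monoid `M`, and equivariant maps. -/
abbrev MSets (M : Type u) [Monoid M] := Action (Type u) M

namespace MSets

variable {M N : Type u} [Monoid M] [Monoid N] (φ : M →* N)

/-- The underlying set of the coinduced `N`-set of an `M`-set `X`:
the `M`-equivariant maps `N → X`. -/
@[ext]
structure CoindSet (X : MSets M) : Type u where
  /-- The underlying function. -/
  toFun : N → X.V
  map_mul : ∀ (m : M) (n : N), toFun (φ m * n) = X.ρ m (toFun n)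

/-- The coinduced `N`-set `Hom_M(N, X)` of an `M`-set `X`, where `n • f = f (- * n)`. -/
def coind (X : MSets M) : MSets N where
  V := CoindSet φ X
  ρ :=
    { toFun := fun n => ↾(fun f : CoindSet φ X =>
        (⟨fun k => f.toFun (k * n), fun m k => by
          rw [mul_assoc, f.map_mul]⟩ : CoindSet φ X))
      map_one' := ConcreteCategory.hom_ext (C := Type u) _ _ fun f =>
        CoindSet.ext (funext fun k => congrArg f.toFun (mul_one k))
      map_mul' := fun a b => ConcreteCategory.hom_ext (C := Type u) _ _ fun f =>
        CoindSet.ext (funext fun k => congrArg f.toFun (mul_assoc k a b).symm) }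

/-- The coinduction functor, which acts on maps by postcomposition. -/
def coindFunctor : MSets M ⥤ MSets N where
  obj X := coind φ X
  map {X Y} g :=
    { hom := ↾(fun f : CoindSet φ X => (⟨fun k => g.hom (f.toFun k), fun m k => by
        change g.hom (f.toFun (φ m * k)) = _
        rw [f.map_mul]
        exact ConcreteCategory.congr_hom (g.comm m) (f.toFun k)⟩ : CoindSet φ Y))
      comm := fun _ => rfl }
  map_id _ := rfl
  map_comp _ _ := rfl

/-- Restriction along `φ` is left adjoint to coinduction along `φ`. -/
def resCoindAdj : Action.res (Type u) φ ⊣ coindFunctor φ where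
  unit :=
    { app := fun Y =>
        { hom := ↾(fun y : Y.V => (⟨fun k => Y.ρ k y, fun m k =>
            ConcreteCategory.congr_hom (C := Type u) (Y.ρ.map_mul (φ m) k) y⟩ :
              CoindSet φ ((Action.res (Type u) φ).obj Y)))
          comm := fun n => ConcreteCategory.hom_ext (C := Type u) _ _ fun y =>
            CoindSet.ext (funext fun k =>
              (ConcreteCategory.congr_hom (C := Type u) (Y.ρ.map_mul k n) y).symm) }
      naturality := fun Y Z g => Action.hom_ext _ _ <|
        ConcreteCategory.hom_ext (C := Type u) _ _ fun y => CoindSet.ext (funext fun k =>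
          (ConcreteCategory.congr_hom (C := Type u) (g.comm k) y).symm) }
  counit :=
    { app := fun X =>
        { hom := ↾(fun f : CoindSet φ X => f.toFun 1)
          comm := fun m => ConcreteCategory.hom_ext (C := Type u) _ _ fun f => by
            change f.toFun (1 * φ m) = X.ρ m (f.toFun 1)
            rw [← f.map_mul, one_mul, mul_one] }
      naturality := fun _ _ _ => rfl }
  left_triangle_components Y := Action.hom_ext _ _ <|
    ConcreteCategory.hom_ext (C := Type u) _ _ fun y =>
      ConcreteCategory.congr_hom (C := Type u) Y.ρ.map_one y
  right_triangle_components X := Action.hom_ext _ _ <|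
    ConcreteCategory.hom_ext (C := Type u) _ _ fun (f : CoindSet φ X) =>
      CoindSet.ext (funext fun k => congrArg f.toFun (one_mul k))

/-- The geometric morphism from `M`-sets to `N`-sets induced by a monoid homomorphism `φ : M → N`:
its inverse image functor is restriction of the action along `φ`. -/
def geom : GeomMorphism (MSets M) (MSets N) where
  direct := coindFunctor φ
  inverse := Action.res (Type u) φ
  adj := resCoindAdj φ
  preservesFiniteLimits := by
    have : PreservesFiniteLimits (Action.res (Type u) φ ⋙ Action.forget (Type u) M) :=
      inferInstanceAs (PreservesFiniteLimits (Action.forget (Type u) N))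
    exact preservesFiniteLimits_of_reflects_of_preserves _ (Action.forget (Type u) M)

end MSets

/-- The free commutative monoid on a set `X`: the finitely supported functions `X → ℕ` under
pointwise addition (written multiplicatively). -/
abbrev FreeCommMonoidOn (X : Type u) := Multiplicative (X →₀ ℕ)

/-- The abelianization map from the free monoid on `X` to the free commutative monoid on `X`,
which sends a finite sequence `s` to the function counting how often each `x` appears in `s`. -/
noncomputable def abelianizationMap (X : Type u) : FreeMonoid X →* FreeCommMonoidOn X := by
  classical exact
  { toFun := fun s => Multiplicative.ofAdd (Multiset.toFinsupp (s.toList : Multiset X))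
    map_one' := by simp
    map_mul' := fun s t => by
      rw [← ofAdd_add, ← map_add, Multiset.coe_add, FreeMonoid.toList_mul] }

theorem abelianizationMap_apply {X : Type u} [DecidableEq X] (s : FreeMonoid X) (x : X) :
    (Multiplicative.toAdd (abelianizationMap X s)) x = s.toList.count x := by
  classical
  simp [abelianizationMap, Multiset.toFinsupp_apply]
  congr!

theorem abelianizationMap_of {X : Type u} (x : X) :
    abelianizationMap X (FreeMonoid.of x) = Multiplicative.ofAdd (Finsupp.single x 1) := by
  classical
  apply Multiplicative.toAdd.injective
  ext y
  rw [abelianizationMap_apply]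
  simp [Finsupp.single_apply, List.count_singleton]

/-! Restriction along a surjection `φ` is hyperconnected, because its image consists of the actions
that only depend on `φ m`. To count points, write `A` for the fibre of `p` at the regular `M`-set.
Then `p^* X` is the tensor product of `A` and `X`, and left exactness makes `A` flat: any two
elements are multiples of a common one. If `M` is cancellative, quotients `a / m` are unique, and
`p` is determined by the set of `m` dividing one chosen `a` (`divTensor_eq_divTensor_iff`). So
classes of points inject into subsets of `M`, which gives the bound `2 ^ |ℝ|`. In a free monoid two
divisors of `a` are suffixes of one word, so there is at most one of each length; the divisor sets
are countable, and there are at most `|ℝ| ^ ℵ₀` classes. Conversely, filtered colimits give a point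
for each `y : ℝ` (allowing division by all powers of `y`) and, in the commutative case, one for each
`S ⊆ ℝ`. Non-surjectivity is then Cantor's theorem. -/

namespace MSets

/-! ### Restriction along a surjective homomorphism -/

section Hyperconnected

variable {M N : Type u} [Monoid M] [Monoid N]

theorem hom_ρ {X Y : MSets M} (f : X ⟶ Y) (m : M) (x : X.V) :
    f.hom (X.ρ m x) = Y.ρ m (f.hom x) :=
  ConcreteCategory.congr_hom (f.comm m) x

theorem ρ_mul (X : MSets M) (m n : M) (x : X.V) : X.ρ (m * n) x = X.ρ m (X.ρ n x) :=
  ConcreteCategory.congr_hom (C := Type u) (X.ρ.map_mul m n) x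

theorem ρ_one (X : MSets M) (x : X.V) : X.ρ 1 x = x :=
  ConcreteCategory.congr_hom (C := Type u) X.ρ.map_one x

theorem hom_congr {X Y : MSets M} {f g : X ⟶ Y} (h : f = g) (x : X.V) : f.hom x = g.hom x := by
  rw [h]

theorem mono_hom_injective {X Y : MSets M} (f : X ⟶ Y) [Mono f] : Function.Injective f.hom :=
  (mono_iff_injective _).1 (inferInstanceAs (Mono ((Action.forget (Type u) M).map f)))

theorem epi_hom_surjective {X Y : MSets M} (f : X ⟶ Y) [Epi f] : Function.Surjective f.hom :=
  (epi_iff_surjective _).1 (inferInstanceAs (Epi ((Action.forget (Type u) M).map f)))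

variable (φ : M →* N)

/-- An `M`-set on which elements with the same image under a surjection `φ : M → N` act in the same
way is restricted from an `N`-set. -/
theorem mem_essImage_res (hφ : Function.Surjective φ) {X : MSets M}
    (h : ∀ m n, φ m = φ n → ∀ x, X.ρ m x = X.ρ n x) : (Action.res (Type u) φ).essImage X := by
  have hs := Function.surjInv_eq hφ
  refine ⟨⟨X.V, ⟨⟨fun n => X.ρ (Function.surjInv hφ n), ?_⟩, ?_⟩⟩, ⟨Action.mkIso (Iso.refl _) ?_⟩⟩
  · refine ConcreteCategory.hom_ext (C := Type u) _ _ fun x => ?_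
    exact (h _ 1 (by rw [hs, map_one]) x).trans (ρ_one X x)
  · intro a b
    refine ConcreteCategory.hom_ext (C := Type u) _ _ fun x => ?_
    exact (h _ _ (by rw [map_mul, hs, hs, hs]) x).trans (ρ_mul X _ _ x)
  · intro m
    ext x
    exact h _ _ (hs _) x

theorem ρ_eq_of_mem_essImage_res {X : MSets M} (hX : (Action.res (Type u) φ).essImage X)
    {m n : M} (hmn : φ m = φ n) (x : X.V) : X.ρ m x = X.ρ n x := by
  obtain ⟨Y, ⟨e⟩⟩ := hX
  obtain ⟨y, rfl⟩ := epi_hom_surjective e.hom x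
  rw [← hom_ρ, ← hom_ρ]
  exact congrArg _ (congrArg (fun k => Y.ρ k y) hmn)

/-- The identities "`m` and `n` act equally when `φ m = φ n`" characterise the essential image, and
they pass to subobjects along injections and to quotients along surjections. -/
theorem geom_isHyperconnected (hφ : Function.Surjective φ) : (geom φ).IsHyperconnected where
  full := ⟨fun {X Y} f => ⟨⟨f.hom, fun n => by
    obtain ⟨m, rfl⟩ := hφ n
    exact f.comm m⟩, rfl⟩⟩
  faithful := ⟨fun {X Y f g} h => Action.hom_ext _ _ (congrArg (fun k => k.hom) h :)⟩
  closedUnderSubobjects := ⟨fun {X Y} f _ hY => mem_essImage_res φ hφ fun m n hmn x =>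
    mono_hom_injective f <| by
      rw [hom_ρ, hom_ρ]
      exact ρ_eq_of_mem_essImage_res φ hY hmn _⟩
  closedUnderQuotients := ⟨fun {X Y} f _ hX => mem_essImage_res φ hφ fun m n hmn y => by
    obtain ⟨x, rfl⟩ := epi_hom_surjective f y
    rw [← hom_ρ, ← hom_ρ, ρ_eq_of_mem_essImage_res φ hX hmn]⟩

end Hyperconnected

/-! ### Points as flat right `M`-sets, and their divisors -/

section Tensor

variable {M : Type u} [Monoid M]

/-- The equivariant map `m ↦ m • x` from `M` to an `M`-set. -/
def orbitMap {X : MSets M} (x : X.V) : Action.leftRegular M ⟶ X where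
  hom := ↾(fun m : M => X.ρ m x)
  comm m := by
    ext n
    exact ρ_mul X m n x

theorem orbitMap_comp {X Y : MSets M} (x : X.V) (f : X ⟶ Y) :
    orbitMap x ≫ f = orbitMap (f.hom x) := by
  ext m
  exact hom_ρ f m x

variable (p : ToposPoint.{u} (MSets M))

/-- The fibre of a point `p` at the regular `M`-set; it is the flat right `M`-set that
represents `p`. -/
abbrev Fibre : Type u := p.inverse.obj (Action.leftRegular M)

variable {p}

/-- The element `a ⊗ x` of `p^* X`, under the identification of `p^* X` with the tensor product
of the fibre of `p` and `X`. For `X = M` it is the right action of `x` on `a`. -/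
def tensor {X : MSets M} (a : Fibre p) (x : X.V) : p.inverse.obj X :=
  p.inverse.map (orbitMap x) a

theorem map_tensor {X Y : MSets M} (f : X ⟶ Y) (a : Fibre p) (x : X.V) :
    p.inverse.map f (tensor a x) = tensor a (f.hom x) := by
  rw [tensor, ← ConcreteCategory.comp_apply, ← p.inverse.map_comp, orbitMap_comp]
  rfl

/-- The right action of `M` on the fibre of a point. -/
def fibreAct (a : Fibre p) (m : M) : Fibre p := tensor (X := Action.leftRegular M) a m

theorem tensor_fibreAct {X : MSets M} (a : Fibre p) (m : M) (x : X.V) :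
    tensor (fibreAct a m) x = tensor a (X.ρ m x) :=
  map_tensor (orbitMap x) a _

theorem fibreAct_mul (a : Fibre p) (m n : M) :
    fibreAct (fibreAct a m) n = fibreAct a (m * n) :=
  tensor_fibreAct (X := Action.leftRegular M) a m n

theorem fibreAct_one (a : Fibre p) : fibreAct a 1 = a := by
  have : orbitMap (X := Action.leftRegular M) (1 : M) = 𝟙 _ := by
    ext m
    exact mul_one (M := M) m
  change p.inverse.map (orbitMap (X := Action.leftRegular M) (1 : M)) a = a
  rw [this, p.inverse.map_id]
  rfl

/-- The orbit maps are jointly epimorphic and `p.inverse` is a left adjoint. Concretely, the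
characteristic map of the set of tensors and the constant map `True` have transposes that agree on
every orbit. -/
theorem exists_tensor_eq {X : MSets M} (y : p.inverse.obj X) :
    ∃ (a : Fibre p) (x : X.V), tensor a x = y := by
  let f : p.inverse.obj X ⟶ ULift.{u} Prop := ↾fun y => ⟨∃ (a : Fibre p) (x : X.V), tensor a x = y⟩
  let g : p.inverse.obj X ⟶ ULift.{u} Prop := ↾fun _ => ⟨True⟩
  suffices h : p.adj.homEquiv _ _ f = p.adj.homEquiv _ _ g by
    have := ConcreteCategory.congr_hom ((p.adj.homEquiv _ _).injective h) y
    exact of_eq_true (congrArg ULift.down this)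
  have key (x : X.V) : orbitMap x ≫ p.adj.homEquiv _ _ f = orbitMap x ≫ p.adj.homEquiv _ _ g := by
    rw [← p.adj.homEquiv_naturality_left, ← p.adj.homEquiv_naturality_left]
    congr 1
    ext a
    exact iff_of_true (⟨a, x, rfl⟩ : ∃ (b : Fibre p) (y : X.V), tensor b y = tensor a x) trivial
  ext x
  have := hom_congr (key x) (1 : M)
  change (p.adj.homEquiv _ _ f).hom (X.ρ 1 x) = (p.adj.homEquiv _ _ g).hom (X.ρ 1 x) at this
  rwa [ρ_one] at this

/-- `p.inverse` preserves the pullback of the two orbit maps, and an element of the image of that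
pullback is itself a tensor `c ⊗ (m, n)`. -/
theorem exists_of_tensor_eq {X : MSets M} {a b : Fibre p} {x y : X.V}
    (h : tensor a x = tensor b y) :
    ∃ (c : Fibre p) (m n : M), fibreAct c m = a ∧ fibreAct c n = b ∧ X.ρ m x = X.ρ n y := by
  have := p.preservesFiniteLimits
  have hp := (IsPullback.of_hasPullback (orbitMap x) (orbitMap y)).map p.inverse
  obtain ⟨z, hz₁, hz₂⟩ := Types.exists_of_isPullback hp a b h
  obtain ⟨c, w, rfl⟩ := exists_tensor_eq z
  refine ⟨c, (pullback.fst (orbitMap x) (orbitMap y)).hom w,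
    (pullback.snd (orbitMap x) (orbitMap y)).hom w, ?_, ?_, ?_⟩
  · rw [← hz₁, map_tensor]; rfl
  · rw [← hz₂, map_tensor]; rfl
  · exact hom_congr (pullback.condition (f := orbitMap x) (g := orbitMap y)) w

theorem nonempty_unique_inverse_obj_terminal : Nonempty (Unique (p.inverse.obj (⊤_ (MSets M)))) := by
  have := p.preservesFiniteLimits
  exact ⟨(Types.isTerminalEquivUnique _) (terminalIsTerminal.isTerminalObj p.inverse _)⟩

variable (p) in
theorem fibre_nonempty : Nonempty (Fibre p) := by
  obtain ⟨h⟩ := nonempty_unique_inverse_obj_terminal (p := p)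
  obtain ⟨a, -, -⟩ := exists_tensor_eq (p := p) h.default
  exact ⟨a⟩

/-- All tensors with a point of the terminal `M`-set coincide, so `exists_of_tensor_eq` applies to
any two elements. -/
theorem exists_fibreAct_eq (a b : Fibre p) :
    ∃ (c : Fibre p) (m n : M), fibreAct c m = a ∧ fibreAct c n = b := by
  obtain ⟨h⟩ := nonempty_unique_inverse_obj_terminal (p := p)
  obtain ⟨-, x, -⟩ := exists_tensor_eq (p := p) h.default
  obtain ⟨c, m, n, ha, hb, -⟩ := exists_of_tensor_eq (a := a) (b := b) (x := x) (y := x)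
    ((h.eq_default _).trans (h.eq_default _).symm)
  exact ⟨c, m, n, ha, hb⟩

theorem fibreAct_right_injective [IsLeftCancelMul M] (a : Fibre p) :
    Function.Injective (fibreAct a : M → Fibre p) := by
  intro m n h
  have := p.preservesFiniteLimits
  let f := orbitMap (X := Action.leftRegular M) m
  let g := orbitMap (X := Action.leftRegular M) n
  -- The preserved equalizer of right multiplication by `m` and by `n` is inhabited, so `w * m = w *
  -- n` for some `w`.
  have hl := isLimitForkMapOfIsLimit p.inverse _ (equalizerIsEqualizer f g)
  obtain ⟨z, -, -⟩ := Types.unique_of_type_equalizer _ _ hl a h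
  obtain ⟨-, w, -⟩ := exists_tensor_eq z
  have hw := hom_congr (equalizer.condition f g) w
  exact mul_left_cancel (G := M) (a := (equalizer.ι f g).hom w) hw

theorem fibreAct_eq_fibreAct {a b : Fibre p} {m n : M} (h : fibreAct a m = fibreAct b n) :
    ∃ (c : Fibre p) (k l : M), fibreAct c k = a ∧ fibreAct c l = b ∧ k * m = l * n :=
  exists_of_tensor_eq (X := Action.leftRegular M) h

theorem fibreAct_left_injective [IsRightCancelMul M] (m : M) :
    Function.Injective (fun a : Fibre p => fibreAct a m) := by
  intro a b h
  obtain ⟨c, k, l, rfl, rfl, hkl⟩ := fibreAct_eq_fibreAct h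
  rw [mul_right_cancel hkl]

/-- The elements of `M` by which an element of the fibre of a point can be divided. -/
def divisors (a : Fibre p) : Set M := {m | ∃ c, fibreAct c m = a}

theorem one_mem_divisors (a : Fibre p) : 1 ∈ divisors a := ⟨a, fibreAct_one a⟩

theorem exists_mul_eq_mul_of_mem_divisors {a : Fibre p} {m n : M} (hm : m ∈ divisors a)
    (hn : n ∈ divisors a) : ∃ k l : M, k * m = l * n := by
  obtain ⟨c, hc⟩ := hm
  obtain ⟨d, hd⟩ := hn
  obtain ⟨-, k, l, -, -, h⟩ := fibreAct_eq_fibreAct (hc.trans hd.symm)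
  exact ⟨k, l, h⟩

/-- The element `(a / m) ⊗ x` of `p^* X`. -/
noncomputable def divTensor (a : Fibre p) {X : MSets M} (z : divisors a × X.V) : p.inverse.obj X :=
  tensor z.1.2.choose z.2

theorem map_divTensor (a : Fibre p) {X Y : MSets M} (f : X ⟶ Y) (z : divisors a × X.V) :
    p.inverse.map f (divTensor a z) = divTensor a (z.1, f.hom z.2) :=
  map_tensor _ _ _

variable [IsCancelMul M]

theorem divTensor_mk {a c : Fibre p} {m : M} (h : fibreAct c m = a) {X : MSets M} (x : X.V) :
    divTensor a (⟨m, c, h⟩, x) = tensor c x := by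
  have hc : (⟨c, h⟩ : ∃ c, fibreAct c m = a).choose = c :=
    fibreAct_left_injective m ((Exists.choose_spec (⟨c, h⟩ : ∃ c, fibreAct c m = a)).trans h.symm)
  exact congrArg (fun d => tensor d x) hc

theorem divTensor_surjective (a : Fibre p) (X : MSets M) :
    Function.Surjective (divTensor a : divisors a × X.V → p.inverse.obj X) := by
  intro y
  obtain ⟨b, x, rfl⟩ := exists_tensor_eq y
  obtain ⟨c, m, n, hm, rfl⟩ := exists_fibreAct_eq a b
  exact ⟨(⟨m, c, hm⟩, X.ρ n x), (divTensor_mk hm _).trans (tensor_fibreAct c n x).symm⟩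

/-- The criterion mentions `p` and `a` only through `divisors a`; this is why the divisors determine
the point. -/
theorem divTensor_eq_divTensor_iff (a : Fibre p) {X : MSets M} (z w : divisors a × X.V) :
    divTensor a z = divTensor a w ↔
      ∃ k l : M, k * z.1 ∈ divisors a ∧ k * z.1 = l * w.1 ∧ X.ρ k z.2 = X.ρ l w.2 := by
  obtain ⟨⟨m, c, hc⟩, x⟩ := z
  obtain ⟨⟨n, d, hd⟩, y⟩ := w
  rw [divTensor_mk hc, divTensor_mk hd]
  constructor
  · intro h
    obtain ⟨e, k, l, rfl, rfl, hkl⟩ := exists_of_tensor_eq h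
    rw [fibreAct_mul] at hc hd
    exact ⟨k, l, ⟨e, hc⟩, fibreAct_right_injective e (hc.trans hd.symm), hkl⟩
  · rintro ⟨k, l, ⟨e, he⟩, h, hkl⟩
    dsimp only at he h hkl
    have hk : fibreAct e k = c := fibreAct_left_injective m <| by
      dsimp only
      rw [fibreAct_mul, he, hc]
    have hl : fibreAct e l = d := fibreAct_left_injective n <| by
      dsimp only
      rw [fibreAct_mul, ← h, he, hd]
    rw [← hk, ← hl, tensor_fibreAct, tensor_fibreAct, hkl]

variable {q : ToposPoint.{u} (MSets M)}

theorem divTensor_inclusion_eq {a : Fibre p} {b : Fibre q} (h : divisors a = divisors b)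
    {X : MSets M} {z w : divisors a × X.V} (hzw : divTensor a z = divTensor a w) :
    divTensor b (Set.inclusion h.le z.1, z.2) = divTensor b (Set.inclusion h.le w.1, w.2) := by
  obtain ⟨k, l, hk, hkl⟩ := (divTensor_eq_divTensor_iff a z w).1 hzw
  exact (divTensor_eq_divTensor_iff b _ _).2 ⟨k, l, h.le hk, hkl⟩

/-- The comparison of two points whose fibres contain elements with the same divisors. -/
noncomputable def divisorsComparison (a : Fibre p) (b : Fibre q) (h : divisors a = divisors b) :
    p.inverse ⟶ q.inverse where
  app X := ↾fun y =>
    divTensor b (Set.inclusion h.le (Function.surjInv (divTensor_surjective a X) y).1,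
      (Function.surjInv (divTensor_surjective a X) y).2)
  naturality X Y f := by
    ext y
    refine Eq.trans ?_ (map_divTensor b f _).symm
    refine divTensor_inclusion_eq h (w := (_, _)) ?_
    exact (Function.surjInv_eq _ _).trans ((congrArg (p.inverse.map f)
      (Function.surjInv_eq (divTensor_surjective a X) y).symm).trans (map_divTensor a f _))

theorem divisorsComparison_app (a : Fibre p) (b : Fibre q) (h : divisors a = divisors b)
    {X : MSets M} (z : divisors a × X.V) :
    (divisorsComparison a b h).app X (divTensor a z) =
      divTensor b (Set.inclusion h.le z.1, z.2) :=
  divTensor_inclusion_eq h (Function.surjInv_eq _ _)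

theorem divisorsComparison_comp (a : Fibre p) (b : Fibre q) (h : divisors a = divisors b) :
    divisorsComparison a b h ≫ divisorsComparison b a h.symm = 𝟙 _ := by
  ext X y
  obtain ⟨z, rfl⟩ := divTensor_surjective a X y
  change (divisorsComparison b a h.symm).app X ((divisorsComparison a b h).app X _) = _
  rw [divisorsComparison_app, divisorsComparison_app]
  rfl

/-- Over a cancellative monoid, a point is determined by the divisors of any element of its
fibre. -/
theorem nonempty_iso_of_divisors_eq (a : Fibre p) (b : Fibre q) (h : divisors a = divisors b) :
    Nonempty (p.inverse ≅ q.inverse) :=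
  ⟨⟨divisorsComparison a b h, divisorsComparison b a h.symm, divisorsComparison_comp a b h,
    divisorsComparison_comp b a h.symm⟩⟩

variable (M) in
/-- The divisors of a chosen element of the fibre of a representative of a class of points. -/
noncomputable def classDivisors (c : PointClasses.{u} (MSets M)) : Set M :=
  divisors (fibre_nonempty c.out).some

variable (M) in
theorem classDivisors_injective : Function.Injective (classDivisors M) := by
  intro c d h
  rw [← Quotient.out_equiv_out]
  exact nonempty_iso_of_divisors_eq _ _ h

end Tensor

/-! ### Upper bounds on the number of points -/

section Cardinality

open Cardinal

variable (M : Type u) [Monoid M] [IsCancelMul M]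

theorem mk_pointClasses_le : #(PointClasses.{u} (MSets M)) ≤ 2 ^ lift.{u + 1} #M := by
  have := lift_mk_le_lift_mk_of_injective (classDivisors_injective M)
  rw [lift_id'.{u, u + 1}] at this
  simpa using this

theorem classDivisors_freeMonoid_countable (X : Type u)
    (c : PointClasses.{u} (MSets (FreeMonoid X))) : (classDivisors _ c).Countable := by
  refine Set.MapsTo.countable_of_injOn (f := FreeMonoid.length) (Set.mapsTo_univ _ _) ?_
    Set.countable_univ
  intro m hm n hn h
  obtain ⟨k, l, hkl⟩ := exists_mul_eq_mul_of_mem_divisors hm hn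
  -- Suffixes of equal length of the same word are equal.
  exact (List.append_inj' (congrArg FreeMonoid.toList hkl) h).2

theorem mk_pointClasses_freeMonoid_le (X : Type u) :
    #(PointClasses.{u} (MSets (FreeMonoid X))) ≤ lift.{u + 1} #(FreeMonoid X) ^ ℵ₀ := by
  choose f hf using fun c : PointClasses.{u} (MSets (FreeMonoid X)) =>
    (classDivisors_freeMonoid_countable X c).exists_eq_range ⟨1, one_mem_divisors _⟩
  have hf' : Function.Injective f := fun c d h =>
    classDivisors_injective _ (by rw [hf, hf, h])
  have := lift_mk_le_lift_mk_of_injective hf'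
  rw [lift_id'.{u, u + 1}] at this
  simpa using this

end Cardinality

/-! ### Points from filtered colimits -/

section FilteredPoints

variable {M : Type u} [Monoid M] {J : Type u} [SmallCategory J]

/-- The point of the topos of `M`-sets given by a filtered diagram in `M`: its inverse image
functor sends an `M`-set to the colimit of the corresponding diagram of copies of it. -/
noncomputable def filteredPoint [IsFiltered J] (D : J ⥤ SingleObj M) :
    ToposPoint.{u} (MSets M) where
  direct := Functor.const J ⋙ D.ran ⋙ (Action.functorCategoryEquivalence (Type u) M).inverse
  inverse := (Action.functorCategoryEquivalence (Type u) M).functor ⋙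
    (Functor.whiskeringLeft _ _ _).obj D ⋙ colim
  adj := (Action.functorCategoryEquivalence (Type u) M).toAdjunction.comp
    ((D.ranAdjunction (Type u)).comp colimConstAdj)
  preservesFiniteLimits := by
    have : PreservesFiniteLimits ((Functor.whiskeringLeft _ _ (Type u)).obj D) := inferInstance
    infer_instance

end FilteredPoints

/-! ### Diagrams of differences, and an invariant separating them -/

section OrderedPoints

variable {M : Type u} [Monoid M] {J : Type u} [AddCommMonoid J] [PartialOrder J]
  [CanonicallyOrderedAdd J] [Sub J] [OrderedSub J] [AddLeftReflectLE J]

/-- The diagram in `M` whose transition from `i` to `j` is `θ (j - i)`. -/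
def diffDiagram (θ : Multiplicative J →* M) : J ⥤ SingleObj M where
  obj _ := SingleObj.star M
  map {i j} _ := θ (Multiplicative.ofAdd (j - i))
  map_id i := by
    rw [tsub_self]
    exact θ.map_one
  map_comp {i j k} f g := by
    rw [SingleObj.comp_as_mul, ← map_mul, ← ofAdd_add, tsub_add_tsub_cancel (leOfHom g) (leOfHom f)]

/-- The `M`-set of truth values on which an element of nonzero degree acts as the constant map at
`False`, and one of degree zero acts as the identity. -/
def degreeSet (χ : M →* Multiplicative ℕ) : MSets M where
  V := ULift.{u} Prop
  ρ :=
    { toFun := fun m => ↾fun b => ⟨b.down ∧ χ m = 1⟩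
      map_one' := ConcreteCategory.hom_ext (C := Type u) _ _ fun b =>
        ULift.ext _ _ (propext (and_iff_left χ.map_one))
      map_mul' := fun m n => ConcreteCategory.hom_ext (C := Type u) _ _ fun b =>
        ULift.ext _ _ <| propext <| by
          change (_ ∧ χ (m * n) = 1) ↔ (_ ∧ χ n = 1) ∧ χ m = 1
          rw [map_mul, mul_eq_one, and_assoc, and_comm (a := χ m = 1)] }

theorem subsingleton_inverse_degreeSet_iff [IsFiltered J] (θ : Multiplicative J →* M)
    (χ : M →* Multiplicative ℕ) :
    Subsingleton ((filteredPoint (diffDiagram θ)).inverse.obj (degreeSet χ)) ↔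
      ∃ j, χ (θ j) ≠ 1 := by
  let G : J ⥤ Type u := diffDiagram θ ⋙
    (Action.functorCategoryEquivalence (Type u) M).functor.obj (degreeSet χ)
  change Subsingleton (colimit G) ↔ _
  constructor
  · intro h
    -- If all transitions have degree zero, the diagram is constant and its colimit still separates
    -- `True` from `False`.
    by_contra! hχ
    let c : Cocone G :=
      { pt := ULift.{u} Prop
        ι :=
          { app := fun _ => 𝟙 (ULift.{u} Prop)
            naturality := fun i j f => ConcreteCategory.hom_ext (C := Type u) _ _ fun b =>
              ULift.ext _ _ (propext (and_iff_left (hχ _))) } }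
    have hc (b : ULift.{u} Prop) : colimit.desc G c (colimit.ι G 0 b) = b :=
      ConcreteCategory.congr_hom (colimit.ι_desc c 0) b
    have := (hc ⟨True⟩).symm.trans ((congrArg _ (Subsingleton.elim _ _)).trans (hc ⟨False⟩))
    exact of_eq_true (congrArg ULift.down this).symm
  · rintro ⟨k, hk⟩
    -- Moving far enough to cross a transition of nonzero degree sends every element to `False`; the
    -- extra `j` lets two elements reach a common stage.
    have key (i j : J) (b : ULift.{u} Prop) :
        colimit.ι G i b = colimit.ι G (i + (j + k.toAdd)) ⟨False⟩ := by
      rw [← colimit.w G (homOfLE (le_self_add : i ≤ i + (j + k.toAdd)))]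
      refine congrArg (colimit.ι G (i + (j + k.toAdd))) (ULift.ext _ _ (propext ?_))
      refine iff_of_false (fun h => hk ?_) not_false
      have h : χ (θ (.ofAdd (i + (j + k.toAdd) - i))) = 1 := h.2
      rw [add_tsub_cancel_left, ofAdd_add, map_mul, map_mul] at h
      exact (mul_eq_one.1 h).2
    refine ⟨fun x y => ?_⟩
    obtain ⟨i, a, rfl⟩ := Types.jointly_surjective' x
    obtain ⟨j, b, rfl⟩ := Types.jointly_surjective' y
    rw [key i j a, key j i b, add_left_comm]

end OrderedPoints

/-! ### Lower bounds on the number of points -/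

section LowerBounds

open Cardinal

variable (X : Type u)

/-- The number of occurrences of `x` in an element of the free commutative monoid. -/
noncomputable def multiplicity (x : X) : FreeCommMonoidOn X →* Multiplicative ℕ :=
  AddMonoidHom.toMultiplicative (Finsupp.applyAddHom x)

theorem le_mk_pointClasses_freeMonoid :
    lift.{u + 1} #X ≤ #(PointClasses.{u} (MSets (FreeMonoid X))) := by
  -- Only the `y`-coordinate of the index matters: transitions are powers of `y`, so the degree in
  -- `y` separates `P y` from the other points.
  let P (y : X) : ToposPoint.{u} (MSets (FreeMonoid X)) := filteredPoint (J := X →₀ ℕ)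
    (diffDiagram ((powersHom _ (FreeMonoid.of y)).comp (multiplicity X y)))
  have hP : Function.Injective fun y => (⟦P y⟧ : PointClasses.{u} (MSets (FreeMonoid X))) := by
    intro y z h
    obtain ⟨e⟩ := Quotient.exact h
    have h := (e.app (degreeSet
      ((multiplicity X y).comp (abelianizationMap X)))).toEquiv.subsingleton_congr
    have hχ (w : X) (n : ℕ) : multiplicity X y (abelianizationMap X (FreeMonoid.of w ^ n)) =
        Multiplicative.ofAdd (Finsupp.single w 1 y) ^ n := by
      rw [map_pow, abelianizationMap_of, map_pow]
      rfl
    rw [subsingleton_inverse_degreeSet_iff, subsingleton_inverse_degreeSet_iff] at h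
    obtain ⟨f, hf⟩ := h.1 ⟨.ofAdd (Finsupp.single y 1), fun h => by
      have h := (hχ y (Finsupp.single y 1 y)).symm.trans h
      rw [Finsupp.single_eq_same, pow_one] at h
      exact one_ne_zero (Multiplicative.ofAdd.injective h)⟩
    by_contra hyz
    refine hf ((hχ z (f.toAdd z)).trans ?_)
    rw [Finsupp.single_eq_of_ne hyz, ofAdd_zero, one_pow]
  have := lift_mk_le_lift_mk_of_injective hP
  rwa [lift_id'.{u, u + 1}] at this

theorem le_mk_pointClasses_freeCommMonoidOn :
    2 ^ lift.{u + 1} #X ≤ #(PointClasses.{u} (MSets (FreeCommMonoidOn X))) := by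
  classical
  -- Transitions are differences restricted to `S`, so the multiplicity of `x` is nonzero on some
  -- transition exactly when `x ∈ S`.
  let P (S : Set X) : ToposPoint.{u} (MSets (FreeCommMonoidOn X)) := filteredPoint (J := X →₀ ℕ)
    (diffDiagram (AddMonoidHom.toMultiplicative (Finsupp.filterAddHom (· ∈ S))))
  have hP : Function.Injective fun S =>
      (⟦P S⟧ : PointClasses.{u} (MSets (FreeCommMonoidOn X))) := by
    intro S T h
    obtain ⟨e⟩ := Quotient.exact h
    ext x
    have h := (e.app (degreeSet (multiplicity X x))).toEquiv.subsingleton_congr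
    have hχ (U : Set X) :
        (∃ f : Multiplicative (X →₀ ℕ), multiplicity X x (AddMonoidHom.toMultiplicative
          (Finsupp.filterAddHom (· ∈ U)) f) ≠ 1) ↔ x ∈ U := by
      constructor
      · rintro ⟨f, hf⟩
        by_contra hx
        exact hf (Finsupp.filter_apply_neg (· ∈ U) f.toAdd hx)
      · intro hx
        refine ⟨.ofAdd (Finsupp.single x 1), fun h => one_ne_zero (α := ℕ) ?_⟩
        refine Eq.trans ?_ ((Finsupp.filter_apply_pos (· ∈ U) (Finsupp.single x 1) hx).symm.trans h)
        exact Finsupp.single_eq_same.symm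
    rwa [subsingleton_inverse_degreeSet_iff, subsingleton_inverse_degreeSet_iff, hχ, hχ] at h
  have := lift_mk_le_lift_mk_of_injective hP
  rw [lift_id'.{u, u + 1}] at this
  simpa using this

end LowerBounds

end MSets

theorem abelianizationMap_surjective (X : Type u) :
    Function.Surjective (abelianizationMap X) := by
  classical
  intro f
  obtain ⟨l, hl⟩ := Quotient.exists_rep (Finsupp.toMultiset f.toAdd)
  refine ⟨FreeMonoid.ofList l, Multiplicative.toAdd.injective (Finsupp.ext fun x => ?_)⟩
  rw [abelianizationMap_apply, FreeMonoid.toList_ofList, ← Multiset.coe_count,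
    ← Finsupp.count_toMultiset]
  exact congrArg _ hl

theorem mainTheorem9 :
    (MSets.geom (abelianizationMap ℝ)).IsHyperconnected ∧
    Cardinal.mk (PointClasses.{0} (MSets (FreeMonoid ℝ))) = Cardinal.continuum ∧
    Cardinal.mk (PointClasses.{0} (MSets (FreeCommMonoidOn ℝ))) =
      2 ^ Cardinal.lift.{1} (Cardinal.mk ℝ) ∧
    ¬ Function.Surjective
      ((MSets.geom (abelianizationMap ℝ)).mapPoints :
        PointClasses.{0} (MSets (FreeMonoid ℝ)) → PointClasses.{0} (MSets (FreeCommMonoidOn ℝ))) := by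
  have h₁ : Cardinal.mk (PointClasses.{0} (MSets (FreeMonoid ℝ))) = Cardinal.continuum := by
    apply le_antisymm
    · refine (MSets.mk_pointClasses_freeMonoid_le ℝ).trans_eq ?_
      simp [FreeMonoid, Cardinal.mk_list_eq_mk, Cardinal.mk_real]
    · simpa [Cardinal.mk_real] using MSets.le_mk_pointClasses_freeMonoid ℝ
  have h₂ : Cardinal.mk (PointClasses.{0} (MSets (FreeCommMonoidOn ℝ))) =
      2 ^ Cardinal.lift.{1} (Cardinal.mk ℝ) := by
    apply le_antisymm
    · refine (MSets.mk_pointClasses_le (FreeCommMonoidOn ℝ)).trans_eq ?_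
      simp [Multiplicative, Cardinal.mk_real, Cardinal.aleph0_le_continuum]
    · exact MSets.le_mk_pointClasses_freeCommMonoidOn ℝ
  refine ⟨MSets.geom_isHyperconnected _ (abelianizationMap_surjective ℝ), h₁, h₂, fun h => ?_⟩
  have := Cardinal.mk_le_of_surjective h
  rw [h₁, h₂, Cardinal.mk_real, Cardinal.lift_continuum] at this
  exact this.not_gt (Cardinal.cantor _)
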